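/- Let $D$ be a natural number, let $\lambda$ be Lebesgue measure on $\mathbb R^D$, and $L^1=L^1(\mathbb R^D,\lambda)$. Fix thresholds $0<s_0\le b_0<b_1\le s_1\le 1$ and a kernel $\kappa\in L^\infty(\mathbb R^D;[0,\infty))$ with compact support and $\int\kappa=1$. Put $\mathfrak s=\mathbf 1_{[s_0,s_1]}$, $\mathfrak b=\mathbf 1_{[b_0,b_1]}$, and define RealLife by $$\mathrm{Life}:L^1\to L^1,\qquad \mathrm{Life}(a)=a\cdot \mathfrak s\circ(\kappa*a)+(1-a)\cdot\mathfrak b\circ(\kappa*a).$$ Let ${}^0\!\mathcal A$ be the set of all $\{0,1\}$-valued $a\in L^1$ such that $M(a):=\lambda\big((\kappa*a)^{-1}\{s_0,b_0,b_1,s_1\}\big)=0$. For $\varepsilon>0$ and $z\in\mathbb Z^D$ let $C(z,\varepsilon)=\varepsilon z+[-\varepsilon/2,\varepsilon/2)^D$, let $\mathcal B_\varepsilon$ be the $\sigma$-algebra generated by these cubes, $L^1_\varepsilon=L^1(\mathbb R^D,\mathcal B_\varepsilon,\lambda)\subset L^1$, $\mathbb E_\varepsilon:L^1\to L^1_\varepsilon$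 the conditional expectation (averaging over each cube), $k_z=\int_{C(z,\varepsilon)}\kappa$, and $(\kappa_\varepsilon*f)(x)=\sum_{z\in\mathbb Z^D}k_z f(x-\varepsilon z)$. Define $$\mathrm{Life}_\varepsilon:L^1\to L^1_\varepsilon,\qquad \mathrm{Life}_\varepsilon(a)=f\cdot\mathfrak s\circ(\kappa_\varepsilon*f)+(1-f)\cdot\mathfrak b\circ(\kappa_\varepsilon*f),\quad f=\mathbb E_\varepsilon[a].$$ A *Larger than Life* (LtL) cellular automaton on $\{0,1\}^{\mathbb Z^D}$ with these thresholds is given by a finite neighbourhood $K\subset\mathbb Z^D$ and weights $c_k\ge 0$ ($k\in K$) with $\sum_{k\in K} c_k=1$: with $\mathfrak K(u)(z)=\sum_{k\in K}c_k\,u(z+k)$, the new state at $z$ is $1$ if $u(z)=1$ and $s_0\le\mathfrak K(u)(z)\le s_1$, or if $u(z)=0$ and $b_0\le\mathfrak K(u)(z)\le b_1$; otherwise it is $0$. It has radius at most $r$ if $K\subset[-r,r]^D$. Its extension to real-valued $u$ is $u\cdot\mathfrak s\circ\mathfrak K(u)+(1-u)\cdot\mathfrak b\circ\mathfrak K(u)$.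 Write $\sigma^v a(x)=a(x+v)$. Let $\Phi_n,\Phi:L^1\to L^1$ be maps and $\mathfrak A\subset L^1$. We say that $(\Phi_n)$ *evolves to* $\Phi$ on $\mathfrak A$ if $\mathfrak A$ is shift-invariant and, whenever $a_n\in L^1$ and $a_n\to a\in\mathfrak A$ in $L^1$: * (still lifes) if $\Phi_n(a_n)=a_n$ for all $n$, then $\Phi(a)=a$; * (oscillators) if $P\ge 1$, $\Phi^p(a)\in\mathfrak A$ for all $0\le p<P$, and $\Phi_n^P(a_n)=a_n$ for all $n$, then $\Phi^P(a)=a$; * (bugs) if $P\ge1$, $\Phi^p(a)\in\mathfrak A$ for all $0\le p<P$, $v_n\to v$ in $\mathbb R^D$, and $\Phi_n^P(a_n)=\sigma^{Pv_n}(a_n)$ for all $n$, then $\Phi^P(a)=\sigma^{Pv}(a)$. **Theorem.** 1. For every $a\in{}^0\!\mathcal A$, $\mathrm{Life}_\varepsilon(a)\to\mathrm{Life}(a)$ in $L^1$ as $\varepsilon\downarrow 0$. 2. There is a constant $C$ such that for every $\varepsilon>0$ there is an LtL cellular automaton with the same thresholds and radius at most $C/\varepsilon$ for which the map $T$ sending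 $a\in L^1_\varepsilon$ to $(\text{value of }a\text{ on }C(z,\varepsilon))_{z\in\mathbb Z^D}$ is an isomorphism of Banach spaces $L^1_\varepsilon\to\ell^1(\mathbb Z^D)$ with $\|a\|_1=\varepsilon^D\|Ta\|_1$, conjugates $\mathrm{Life}_\varepsilon$ on $L^1_\varepsilon$ to the extension of that automaton on $\ell^1(\mathbb Z^D)$, and restricts to a bijection from the $\{0,1\}$-valued elements of $L^1_\varepsilon$ (a set that $\mathrm{Life}_\varepsilon$ maps into itself) onto the finitely supported elements of $\{0,1\}^{\mathbb Z^D}$, which conjugates $\mathrm{Life}_\varepsilon$ to that automaton. 3. For every sequence $\varepsilon_n>0$ with $\varepsilon_n\to0$, the sequence $(\mathrm{Life}_{\varepsilon_n})$ evolves to $\mathrm{Life}$ on ${}^0\!\mathcal A$. -/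

import Mathlib

open MeasureTheory Filter Topology Set
open scoped Convolution

namespace RealLife

noncomputable section

/-! ### The spaces `𝐋¹(ℝ^D)` and `ℓ¹(ℤ^D)` -/

/-- `𝐋¹(ℝ^D)` with respect to Lebesgue measure.  (Only the topology and the Lebesgue measure of
`ℝ^D` matter below, not the choice of a norm on it.) -/
abbrev L1 (D : ℕ) : Type := Lp ℝ 1 (volume : Measure (Fin D → ℝ))

/-- `ℓ¹(ℤ^D)`. -/
abbrev SeqL1 (D : ℕ) : Type := lp (fun _ : Fin D → ℤ => ℝ) 1

/-- The shift `(σ^v a)(x) = a (x + v)` on `𝐋¹`. -/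
def shift {D : ℕ} (v : Fin D → ℝ) (a : L1 D) : L1 D :=
  Lp.compMeasurePreserving (fun x => x + v) (measurePreserving_add_right volume v) a

/-- `¹𝒜`: the `{0,1}`-valued configurations in `𝐋¹` (i.e. with support of finite measure). -/
def configs (D : ℕ) : Set (L1 D) := {a | ∀ᵐ x, a x = 0 ∨ a x = 1}

/-! ### Life forms and evolution -/

/-- `a` is a still life for `Φ`. -/
def IsStillLife {D : ℕ} (Φ : L1 D → L1 D) (a : L1 D) : Prop := Φ a = a

/-- `a` is a `p`-oscillator for `Φ`. -/
def IsOscillator {D : ℕ} (Φ : L1 D → L1 D) (p : ℕ) (a : L1 D) : Prop := Φ^[p] a = a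

/-- `a` is a `p`-periodic bug with velocity `v` for `Φ`. -/
def IsBug {D : ℕ} (Φ : L1 D → L1 D) (p : ℕ) (v : Fin D → ℝ) (a : L1 D) : Prop :=
  Φ^[p] a = shift ((p : ℝ) • v) a

/-- The sequence `Φₙ` evolves to `Φ` on the shift-invariant set `A`. -/
structure EvolvesOn {D : ℕ} (Φs : ℕ → L1 D → L1 D) (Φ : L1 D → L1 D) (A : Set (L1 D)) :
    Prop where
  shift_invariant : ∀ (v : Fin D → ℝ), ∀ a ∈ A, shift v a ∈ A
  stillLife : ∀ (as : ℕ → L1 D) (a : L1 D), a ∈ A → Tendsto as atTop (𝓝 a) →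
    (∀ n, IsStillLife (Φs n) (as n)) → IsStillLife Φ a
  oscillator : ∀ (as : ℕ → L1 D) (a : L1 D), a ∈ A → Tendsto as atTop (𝓝 a) →
    ∀ P : ℕ, 0 < P → (∀ p < P, Φ^[p] a ∈ A) →
    (∀ n, IsOscillator (Φs n) P (as n)) → IsOscillator Φ P a
  bug : ∀ (as : ℕ → L1 D) (a : L1 D), a ∈ A → Tendsto as atTop (𝓝 a) →
    ∀ P : ℕ, 0 < P → (∀ p < P, Φ^[p] a ∈ A) →
    ∀ (vs : ℕ → Fin D → ℝ) (v : Fin D → ℝ), Tendsto vs atTop (𝓝 v) →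
    (∀ n, IsBug (Φs n) P (vs n) (as n)) → IsBug Φ P v a

/-! ### Thresholds, kernels and RealLife -/

/-- Threshold four-tuples `0 < s₀ ≤ b₀ < b₁ ≤ s₁ ≤ 1`. -/
structure Thresholds where
  s₀ : ℝ
  b₀ : ℝ
  b₁ : ℝ
  s₁ : ℝ
  s₀_pos : 0 < s₀
  s₀_le_b₀ : s₀ ≤ b₀
  b₀_lt_b₁ : b₀ < b₁
  b₁_le_s₁ : b₁ ≤ s₁
  s₁_le_one : s₁ ≤ 1

/-- Kernels: nonnegative, essentially bounded functions with compact (essential) support and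
integral one. -/
structure LifeKernel (D : ℕ) where
  toFun : (Fin D → ℝ) → ℝ
  memLp_top : MemLp toFun ⊤ volume
  nonneg : ∀ᵐ x, 0 ≤ toFun x
  compact_support : ∃ K : Set (Fin D → ℝ), IsCompact K ∧ ∀ᵐ x, x ∉ K → toFun x = 0
  integral_eq_one : ∫ x, toFun x = 1

/-- `t · 𝔰(α) + (1 - t) · 𝔟(α)`, where `𝔰`, `𝔟` are the indicator functions of the survival
interval `[s₀, s₁]` and of the birth interval `[b₀, b₁]`. -/
def lifeRule (θ : Thresholds) (t α : ℝ) : ℝ :=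
  t * (Icc θ.s₀ θ.s₁).indicator 1 α + (1 - t) * (Icc θ.b₀ θ.b₁).indicator 1 α

/-- The convolution `κ * a (x) = ∫ κ(y) a(x - y) dy`. -/
def conv {D : ℕ} (κ : LifeKernel D) (a : L1 D) : (Fin D → ℝ) → ℝ :=
  κ.toFun ⋆[ContinuousLinearMap.mul ℝ ℝ, volume] a

theorem LifeKernel.integrable {D : ℕ} (κ : LifeKernel D) : Integrable κ.toFun volume := by
  by_contra h
  have h1 := κ.integral_eq_one
  rw [integral_undef h] at h1
  exact zero_ne_one h1

theorem integrable_conv {D : ℕ} (κ : LifeKernel D) (a : L1 D) :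
    Integrable (conv κ a) volume :=
  κ.integrable.integrable_convolution _ (L1.integrable_coeFn a)

theorem integrable_lifeRule {D : ℕ} (θ : Thresholds) {f α : (Fin D → ℝ) → ℝ}
    (hf : Integrable f volume) (hα : Integrable α volume) :
    Integrable (fun x => lifeRule θ (f x) (α x)) volume := by
  have hb0 : 0 < θ.b₀ := θ.s₀_pos.trans_le θ.s₀_le_b₀
  have key : ∀ {u v : ℝ}, 0 < u → Integrable (fun x => (Icc u v).indicator (1 : ℝ → ℝ) (α x))
      volume := by
    intro u v hu
    have hm : AEStronglyMeasurable (fun x => (Icc u v).indicator (1 : ℝ → ℝ) (α x)) volume :=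
      ((measurable_one.indicator measurableSet_Icc).comp_aemeasurable
        hα.aemeasurable).aestronglyMeasurable
    refine Integrable.mono (hα.const_mul u⁻¹) hm (Eventually.of_forall fun x => ?_)
    by_cases hx : α x ∈ Icc u v
    · rw [indicator_of_mem hx]
      have h0 : 0 ≤ u⁻¹ * α x := mul_nonneg (inv_nonneg.2 hu.le) (hu.le.trans hx.1)
      rw [Real.norm_of_nonneg h0, Pi.one_apply, norm_one, inv_mul_eq_div, one_le_div hu]
      exact hx.1
    · rw [indicator_of_notMem hx, norm_zero]
      exact norm_nonneg _
  have bd : ∀ {u v : ℝ} (x : Fin D → ℝ), ‖(Icc u v).indicator (1 : ℝ → ℝ) (α x)‖ ≤ 1 := by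
    intro u v x
    by_cases hx : α x ∈ Icc u v
    · rw [indicator_of_mem hx]; simp
    · rw [indicator_of_notMem hx]; simp
  have hs := key (v := θ.s₁) θ.s₀_pos
  have hb := key (v := θ.b₁) hb0
  have h1 := hf.mul_bdd (c := 1) hs.aestronglyMeasurable (Eventually.of_forall fun x => bd x)
  have h2 := hf.mul_bdd (c := 1) hb.aestronglyMeasurable (Eventually.of_forall fun x => bd x)
  refine (h1.add (hb.sub h2)).congr (Eventually.of_forall fun x => ?_)
  simp only [lifeRule, Pi.add_apply, Pi.sub_apply]
  ring

/-- The RealLife Euclidean automaton on `𝐋¹`: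
`Life(a) = a · 𝔰 ∘ (κ * a) + (1 - a) · 𝔟 ∘ (κ * a)`. -/
def realLife {D : ℕ} (θ : Thresholds) (κ : LifeKernel D) (a : L1 D) : L1 D :=
  (memLp_one_iff_integrable.2
    (integrable_lifeRule θ (L1.integrable_coeFn a) (integrable_conv κ a))).toLp
    (fun x => lifeRule θ (a x) (conv κ a x))

/-- `⁰𝒜`: the configurations `a ∈ ¹𝒜` with `M(a) = λ[(κ * a)⁻¹{s₀, b₀, s₁, b₁}] = 0`. -/
def regularConfigs {D : ℕ} (θ : Thresholds) (κ : LifeKernel D) : Set (L1 D) :=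
  {a | a ∈ configs D ∧ volume (conv κ a ⁻¹' {θ.s₀, θ.b₀, θ.s₁, θ.b₁}) = 0}

/-! ### The discretized automata -/

/-- The grid point `ε z`. -/
def gridPoint {D : ℕ} (ε : ℝ) (z : Fin D → ℤ) : Fin D → ℝ := fun i => ε * z i

/-- The half-open cube `ε z + [-ε/2, ε/2)^D`. -/
def cube {D : ℕ} (ε : ℝ) (z : Fin D → ℤ) : Set (Fin D → ℝ) :=
  univ.pi fun i => Ico (ε * z i - ε / 2) (ε * z i + ε / 2)

/-- The index of the cube that contains `x`. -/
def cubeIndex {D : ℕ} (ε : ℝ) (x : Fin D → ℝ) : Fin D → ℤ := fun i => ⌊x i / ε + 1 / 2⌋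

theorem mem_cube_iff {D : ℕ} {ε : ℝ} (hε : 0 < ε) (x : Fin D → ℝ) (z : Fin D → ℤ) :
    x ∈ cube ε z ↔ cubeIndex ε x = z := by
  simp only [cube, mem_univ_pi, mem_Ico, funext_iff, cubeIndex, Int.floor_eq_iff]
  refine forall_congr' fun i => ?_
  have h : x i = ε * (x i / ε) := by field_simp
  constructor
  · rintro ⟨h1, h2⟩
    rw [h] at h1 h2
    constructor <;> nlinarith
  · rintro ⟨h1, h2⟩
    rw [h]
    constructor <;> nlinarith

/-- The sigma-algebra `ℬ_ε` generated by the cubes of side `ε` centred at the grid points. -/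
@[reducible] def gridSigma (D : ℕ) (ε : ℝ) : MeasurableSpace (Fin D → ℝ) :=
  MeasurableSpace.generateFrom (range (cube ε))

/-- `𝐋¹_ε = 𝐋¹(ℝ^D, ℬ_ε, λ)`, as a subspace of `𝐋¹`. -/
abbrev GridL1 (D : ℕ) (ε : ℝ) : Submodule ℝ (L1 D) := lpMeas ℝ ℝ (gridSigma D ε) 1 volume

/-- The conditional expectation with respect to `ℬ_ε`: at `x` it is the average of `a` over the
cube that contains `x`. -/
def gridExp {D : ℕ} (ε : ℝ) (a : L1 D) (x : Fin D → ℝ) : ℝ :=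
  (ε ^ D)⁻¹ * ∫ c in cube ε (cubeIndex ε x), a c

/-- The mass `k_z = ∫_{C(z,ε)} κ` that the discretized kernel `κ_ε = ∑_z k_z δ_{εz}` puts on the
grid point `ε z`. -/
def gridMass {D : ℕ} (κ : LifeKernel D) (ε : ℝ) (z : Fin D → ℤ) : ℝ :=
  ∫ c in cube ε z, κ.toFun c

/-- The convolution `κ_ε * f (x) = ∑_z k_z f(x - ε z)`. -/
def gridConv {D : ℕ} (κ : LifeKernel D) (ε : ℝ) (f : (Fin D → ℝ) → ℝ) (x : Fin D → ℝ) : ℝ :=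
  ∑' z : Fin D → ℤ, gridMass κ ε z * f (x - gridPoint ε z)

theorem measurableSet_cube {D : ℕ} (ε : ℝ) (z : Fin D → ℤ) : MeasurableSet (cube ε z) :=
  MeasurableSet.univ_pi fun _ => measurableSet_Ico

theorem volume_cube {D : ℕ} (ε : ℝ) (z : Fin D → ℤ) :
    volume (cube ε z) = ENNReal.ofReal ε ^ D := by
  rw [cube, volume_pi_pi]
  simp [Real.volume_Ico]

theorem measurable_cubeIndex {D : ℕ} {ε : ℝ} (hε : 0 < ε) :
    Measurable[gridSigma D ε] (cubeIndex (D := D) ε) := by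
  refine @measurable_to_countable' _ _ _ _ (gridSigma D ε) _ fun z => ?_
  have : cubeIndex ε ⁻¹' {z} = cube ε z := by
    ext x; simp [mem_cube_iff hε]
  rw [this]
  exact MeasurableSpace.measurableSet_generateFrom (mem_range_self z)

theorem gridSigma_le {D : ℕ} (ε : ℝ) : gridSigma D ε ≤ MeasurableSpace.pi := by
  refine MeasurableSpace.generateFrom_le ?_
  rintro _ ⟨z, rfl⟩
  exact measurableSet_cube ε z

theorem cubeIndex_sub_gridPoint {D : ℕ} {ε : ℝ} (hε : 0 < ε) (x : Fin D → ℝ) (z : Fin D → ℤ) :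
    cubeIndex ε (x - gridPoint ε z) = cubeIndex ε x - z := by
  funext i
  simp only [cubeIndex, gridPoint, Pi.sub_apply]
  rw [← Int.floor_sub_intCast]
  congr 1
  field_simp
  ring

theorem measurable_gridExp {D : ℕ} {ε : ℝ} (hε : 0 < ε) (a : L1 D) :
    Measurable[gridSigma D ε] (gridExp ε a) :=
  (measurable_of_countable fun z : Fin D → ℤ => (ε ^ D)⁻¹ * ∫ c in cube ε z, a c).comp
    (measurable_cubeIndex hε)

theorem iUnion_cube {D : ℕ} {ε : ℝ} (hε : 0 < ε) : (⋃ z, cube (D := D) ε z) = univ :=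
  eq_univ_of_forall fun x => mem_iUnion.2 ⟨cubeIndex ε x, (mem_cube_iff hε x _).2 rfl⟩

theorem disjoint_cube {D : ℕ} {ε : ℝ} (hε : 0 < ε) :
    Pairwise (Function.onFun Disjoint (cube (D := D) ε)) := by
  intro z w hzw
  refine Set.disjoint_left.2 fun x hx hx' => hzw ?_
  rw [← (mem_cube_iff hε x z).1 hx, (mem_cube_iff hε x w).1 hx']

theorem integrable_gridExp {D : ℕ} {ε : ℝ} (hε : 0 < ε) (a : L1 D) :
    Integrable (gridExp ε a) volume := by
  refine ⟨((measurable_gridExp hε a).mono (gridSigma_le ε) le_rfl).aestronglyMeasurable, ?_⟩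
  have ha : ∫⁻ x, ‖a x‖ₑ < ⊤ := (L1.integrable_coeFn a).2
  refine lt_of_le_of_lt ?_ ha
  rw [← setLIntegral_univ (fun x => ‖gridExp ε a x‖ₑ), ← setLIntegral_univ (fun x => ‖a x‖ₑ),
    ← iUnion_cube (D := D) hε,
    lintegral_iUnion (fun z => measurableSet_cube ε z) (disjoint_cube hε),
    lintegral_iUnion (fun z => measurableSet_cube ε z) (disjoint_cube hε)]
  refine ENNReal.tsum_le_tsum fun z => ?_
  have h1 : ∫⁻ x in cube ε z, ‖gridExp ε a x‖ₑ =
      ∫⁻ _ in cube ε z, ‖(ε ^ D)⁻¹ * ∫ c in cube ε z, a c‖ₑ := by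
    refine setLIntegral_congr_fun (measurableSet_cube ε z) fun x hx => ?_
    simp only [gridExp, (mem_cube_iff hε x z).1 hx]
  have hp : 0 < ε ^ D := pow_pos hε D
  rw [h1, setLIntegral_const, volume_cube, enorm_mul, mul_right_comm, ← ENNReal.ofReal_pow hε.le]
  have h2 : ‖(ε ^ D)⁻¹‖ₑ * ENNReal.ofReal (ε ^ D) = 1 := by
    rw [Real.enorm_eq_ofReal (inv_nonneg.2 hp.le), ← ENNReal.ofReal_mul (inv_nonneg.2 hp.le),
      inv_mul_cancel₀ hp.ne', ENNReal.ofReal_one]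
  rw [h2, one_mul]
  exact enorm_integral_le_lintegral_enorm _

theorem finite_support_gridMass {D : ℕ} (κ : LifeKernel D) {ε : ℝ} (hε : 0 < ε) :
    (Function.support (gridMass κ ε)).Finite := by
  obtain ⟨K, hK, hK0⟩ := κ.compact_support
  obtain ⟨R, hR⟩ := hK.isBounded.exists_norm_le
  refine (Set.finite_Icc (fun _ : Fin D => ⌊-R / ε + 1 / 2⌋)
    (fun _ : Fin D => ⌊R / ε + 1 / 2⌋)).subset ?_
  intro z hz
  by_contra hz'
  apply hz
  refine integral_eq_zero_of_ae ?_
  rw [Filter.EventuallyEq, ae_restrict_iff' (measurableSet_cube ε z)]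
  filter_upwards [hK0] with x hx hxz
  refine hx fun hxK => hz' ?_
  have hb : ∀ i, |x i| ≤ R := fun i => (norm_le_pi_norm x i).trans (hR x hxK)
  rw [← (mem_cube_iff hε x z).1 hxz]
  constructor <;> intro i <;> refine Int.floor_le_floor ?_
  · have := (abs_le.1 (hb i)).1
    gcongr
  · have := (abs_le.1 (hb i)).2
    gcongr

theorem gridConv_eq_sum {D : ℕ} (κ : LifeKernel D) {ε : ℝ} (hε : 0 < ε)
    (f : (Fin D → ℝ) → ℝ) (x : Fin D → ℝ) :
    gridConv κ ε f x = ∑ z ∈ (finite_support_gridMass κ hε).toFinset,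
      gridMass κ ε z * f (x - gridPoint ε z) := by
  refine tsum_eq_sum fun z hz => ?_
  have : gridMass κ ε z = 0 := by simpa using hz
  rw [this, zero_mul]

theorem integrable_gridConv {D : ℕ} (κ : LifeKernel D) {ε : ℝ} (hε : 0 < ε)
    {f : (Fin D → ℝ) → ℝ} (hf : Integrable f volume) :
    Integrable (gridConv κ ε f) volume := by
  rw [funext (gridConv_eq_sum κ hε f)]
  exact integrable_finsetSum _ fun z _ => (hf.comp_sub_right _).const_mul _

theorem measurable_gridConv_gridExp {D : ℕ} (κ : LifeKernel D) {ε : ℝ} (hε : 0 < ε)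
    (a : L1 D) : Measurable[gridSigma D ε] (gridConv κ ε (gridExp ε a)) := by
  have h : gridConv κ ε (gridExp ε a) =
      (fun w : Fin D → ℤ => ∑' z : Fin D → ℤ,
        gridMass κ ε z * ((ε ^ D)⁻¹ * ∫ c in cube ε (w - z), a c)) ∘ cubeIndex ε := by
    funext x
    simp only [gridConv, gridExp, Function.comp_apply, cubeIndex_sub_gridPoint hε]
  rw [h]
  exact (measurable_of_countable _).comp (measurable_cubeIndex hε)

theorem measurable_lifeRule (θ : Thresholds) :
    Measurable (fun p : ℝ × ℝ => lifeRule θ p.1 p.2) := by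
  unfold lifeRule
  have hs : Measurable ((Icc θ.s₀ θ.s₁).indicator (1 : ℝ → ℝ)) :=
    measurable_one.indicator measurableSet_Icc
  have hb : Measurable ((Icc θ.b₀ θ.b₁).indicator (1 : ℝ → ℝ)) :=
    measurable_one.indicator measurableSet_Icc
  exact (measurable_fst.mul (hs.comp measurable_snd)).add
    ((measurable_const.sub measurable_fst).mul (hb.comp measurable_snd))

/-- The discretized automaton `Life_ε : 𝐋¹ → 𝐋¹_ε`.  With `f = 𝔼_ε[a]`,
`Life_ε(a) = f · 𝔰 ∘ (κ_ε * f) + (1 - f) · 𝔟 ∘ (κ_ε * f)`. -/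
def discreteLife {D : ℕ} (θ : Thresholds) (κ : LifeKernel D) (ε : ℝ) (hε : 0 < ε) (a : L1 D) :
    GridL1 D ε :=
  have h : Integrable
      (fun x => lifeRule θ (gridExp ε a x) (gridConv κ ε (gridExp ε a) x)) volume :=
    integrable_lifeRule θ (integrable_gridExp hε a)
      (integrable_gridConv κ hε (integrable_gridExp hε a))
  ⟨(memLp_one_iff_integrable.2 h).toLp
      (fun x => lifeRule θ (gridExp ε a x) (gridConv κ ε (gridExp ε a) x)),
    mem_lpMeas_iff_aestronglyMeasurable.2
      ⟨fun x => lifeRule θ (gridExp ε a x) (gridConv κ ε (gridExp ε a) x),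
        (((measurable_lifeRule θ).comp ((measurable_gridExp hε a).prodMk
          (measurable_gridConv_gridExp κ hε a))).stronglyMeasurable),
        MemLp.coeFn_toLp _⟩⟩

/-! ### Larger than Life cellular automata -/

/-- The data of a Larger than Life cellular automaton on `ℤ^D` (apart from its thresholds): a
finite neighbourhood and nonnegative weights of total mass one. -/
structure LtLData (D : ℕ) where
  nbhd : Finset (Fin D → ℤ)
  weight : (Fin D → ℤ) → ℝ
  weight_nonneg : ∀ k ∈ nbhd, 0 ≤ weight k
  weight_sum : ∑ k ∈ nbhd, weight k = 1

/-- The weighted local density `𝔎(u)(z) = ∑_{k ∈ nbhd} c_k u(z + k)`. -/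
def LtLData.density {D : ℕ} (N : LtLData D) (u : (Fin D → ℤ) → ℝ) (z : Fin D → ℤ) : ℝ :=
  ∑ k ∈ N.nbhd, N.weight k * u (z + k)

/-- The Larger than Life cellular automaton with survival interval `[s₀, s₁]` and birth interval
`[b₀, b₁]`, acting on the configurations `u : ℤ^D → {0,1} ⊆ ℝ`. -/
def LtLData.automaton {D : ℕ} (N : LtLData D) (θ : Thresholds) (u : (Fin D → ℤ) → ℝ)
    (z : Fin D → ℤ) : ℝ :=
  open Classical in
  if u z = 1 ∧ θ.s₀ ≤ N.density u z ∧ N.density u z ≤ θ.s₁ then 1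
  else if u z = 0 ∧ θ.b₀ ≤ N.density u z ∧ N.density u z ≤ θ.b₁ then 1
  else 0

/-- The extension `u ↦ u · 𝔰 ∘ 𝔎(u) + (1 - u) · 𝔟 ∘ 𝔎(u)` of the automaton to real-valued `u`. -/
def LtLData.extended {D : ℕ} (N : LtLData D) (θ : Thresholds) (u : (Fin D → ℤ) → ℝ)
    (z : Fin D → ℤ) : ℝ :=
  lifeRule θ (u z) (N.density u z)

/-- `N` has radius at most `r`: its neighbourhood lies in the box `[-r, r]^D`. -/
def LtLData.RadiusLE {D : ℕ} (N : LtLData D) (r : ℝ) : Prop :=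
  ∀ k ∈ N.nbhd, ∀ i, |(k i : ℝ)| ≤ r

/-- `¹𝒜(ℤ^D)`: the `{0,1}`-valued configurations on `ℤ^D` with finite support. -/
def latticeConfigs (D : ℕ) : Set (SeqL1 D) :=
  {u | (∀ z, u z = 0 ∨ u z = 1) ∧ (Function.support (u : (Fin D → ℤ) → ℝ)).Finite}

/-- The bijection `T : 𝐋¹_ε ≅ ℓ¹(ℤ^D)`, which sends `a` to its values on the cubes of side `ε`,
is an isomorphism of dynamical systems from `Life_ε` to the (extended) Larger than Life automaton
given by `N` and `θ`, and it restricts to an isomorphism from `Life_ε`, acting on the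
configurations in `𝐋¹_ε`, to that automaton, acting on the configurations of finite support. -/
structure IsLifeIsomorphism {D : ℕ} (θ : Thresholds) (κ : LifeKernel D) (ε : ℝ) (hε : 0 < ε)
    (N : LtLData D) (T : GridL1 D ε ≃L[ℝ] SeqL1 D) : Prop where
  sample : ∀ a : GridL1 D ε, ((a : L1 D) : (Fin D → ℝ) → ℝ) =ᵐ[volume]
    fun x => T a (cubeIndex ε x)
  norm_eq : ∀ a : GridL1 D ε, ‖a‖ = ε ^ D * ‖T a‖
  conj : ∀ a : GridL1 D ε, (T (discreteLife θ κ ε hε a) : (Fin D → ℤ) → ℝ) =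
    N.extended θ (T a)
  mem_configs_iff : ∀ a : GridL1 D ε, (a : L1 D) ∈ configs D ↔ T a ∈ latticeConfigs D
  mapsTo_configs : ∀ a : GridL1 D ε, (a : L1 D) ∈ configs D →
    (discreteLife θ κ ε hε a : L1 D) ∈ configs D
  conj_configs : ∀ a : GridL1 D ε, (a : L1 D) ∈ configs D →
    (T (discreteLife θ κ ε hε a) : (Fin D → ℤ) → ℝ) = N.automaton θ (T a)

end

end RealLife

namespace RealLife

/-! ### Convergence and translations in `𝐋¹` -/

/-! The analytic core is continuous convergence, `tendsto_discreteLife`: if `aₙ → a` in `𝐋¹`, `a` is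
regular and `εₙ → 0`, then `Life_{εₙ}(aₙ) → Life(a)`. Constant sequences `aₙ = a` give the first
claim. For the third, continuous convergence passes to iterates as long as the orbit of the limit
stays regular, shifts are jointly continuous, and limits in `𝐋¹` are unique
(`evolvesOn_of_tendsto`).

For continuous convergence, `𝔼_ε` and `κ_ε *` are contractions of `𝐋¹`, so only their action on the
fixed `a` matters; there, continuity of translation gives `𝔼_ε[a] → a` and `κ_ε * a → κ * a`. The
indicators `𝔰`, `𝔟` are continuous off the thresholds, which `κ * a` avoids almost everywhere.
Dominated convergence along subsequences then gives the limit (`tendsto_lintegral_lifeRule`). The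
factor `1 - a` is not integrable; domination works because `b₀ > 0` makes the birth indicator at
most `|α| / b₀`.

The second claim is exact at every scale: a `ℬ_ε`-measurable function factors through the cube
index, so `𝐋¹_ε` is a rescaled `ℓ¹(ℤ^D)`, and `κ_ε *` becomes a finite weighted sum with nonnegative
weights of total mass one. -/

theorem coeFn_shift {D : ℕ} (v : Fin D → ℝ) (a : L1 D) :
    (shift v a : (Fin D → ℝ) → ℝ) =ᵐ[volume] fun x => a (x + v) :=
  Lp.coeFn_compMeasurePreserving a (measurePreserving_add_right volume v)

/-- Joint continuity is needed because the velocities of approximating bugs vary along with the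
bugs. -/
theorem tendsto_shift {D : ℕ} {ι : Type*} {l : Filter ι} {as : ι → L1 D} {a : L1 D}
    {vs : ι → Fin D → ℝ} {v : Fin D → ℝ} (ha : Tendsto as l (𝓝 a)) (hv : Tendsto vs l (𝓝 v)) :
    Tendsto (fun n => shift (vs n) (as n)) l (𝓝 (shift v a)) := by
  -- Currying addition makes the translation depend continuously on its vector in the compact-open
  -- topology.
  let g : C(Fin D → ℝ, C(Fin D → ℝ, Fin D → ℝ)) :=
    ContinuousMap.curry ⟨fun p => p.2 + p.1, by fun_prop⟩
  have hg : Tendsto (fun n => g (vs n)) l (𝓝 (g v)) := (g.continuous.tendsto v).comp hv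
  exact ha.compMeasurePreservingLp hg (fun n => measurePreserving_add_right volume (vs n))
    (measurePreserving_add_right volume v) ENNReal.one_ne_top

theorem tendsto_L1_iff_lintegral {D : ℕ} {ι : Type*} {l : Filter ι} {as : ι → L1 D} {a : L1 D} :
    Tendsto as l (𝓝 a) ↔ Tendsto (fun n => ∫⁻ x, ‖as n x - a x‖ₑ) l (𝓝 0) := by
  rw [Lp.tendsto_Lp_iff_tendsto_eLpNorm']
  simp only [eLpNorm_one_eq_lintegral_enorm, Pi.sub_apply]

theorem exists_lintegral_translate_le {D : ℕ} (a : L1 D) {η : ENNReal} (hη : 0 < η) :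
    ∃ δ > 0, ∀ h : Fin D → ℝ, ‖h‖ < δ → ∫⁻ x, ‖a (x + h) - a x‖ₑ ≤ η := by
  have h1 : Tendsto (fun h : Fin D → ℝ => shift h a) (𝓝 0) (𝓝 (shift 0 a)) :=
    tendsto_shift tendsto_const_nhds tendsto_id
  rw [tendsto_L1_iff_lintegral, ENNReal.tendsto_nhds_zero] at h1
  obtain ⟨δ, hδ, h2⟩ := Metric.eventually_nhds_iff.1 (h1 η hη)
  refine ⟨δ, hδ, fun h hh => le_trans (le_of_eq ?_) (h2 (y := h) (by simpa using hh))⟩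
  refine lintegral_congr_ae ?_
  filter_upwards [coeFn_shift h a, coeFn_shift 0 a] with x hx hx0
  rw [hx, hx0, add_zero]

theorem lintegral_enorm_sub_le {α : Type*} [MeasurableSpace α] {μ : Measure α} {f g h : α → ℝ}
    (hf : AEStronglyMeasurable f μ) (hg : AEStronglyMeasurable g μ) :
    ∫⁻ x, ‖f x - h x‖ₑ ∂μ ≤ ∫⁻ x, ‖f x - g x‖ₑ ∂μ + ∫⁻ x, ‖g x - h x‖ₑ ∂μ := by
  have hfg : AEMeasurable (fun x => ‖f x - g x‖ₑ) μ := (hf.sub hg).enorm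
  rw [← lintegral_add_left' hfg]
  refine lintegral_mono fun x => ?_
  rw [← sub_add_sub_cancel (f x) (g x) (h x)]
  exact enorm_add_le _ _

/-! ### The conditional expectation -/

theorem gridExp_sub {D : ℕ} (ε : ℝ) (a b : L1 D) (x : Fin D → ℝ) :
    gridExp ε (a - b) x = gridExp ε a x - gridExp ε b x := by
  simp only [gridExp]
  rw [← mul_sub, ← integral_sub (L1.integrable_coeFn a).integrableOn
    (L1.integrable_coeFn b).integrableOn]
  congr 1
  refine setIntegral_congr_ae (measurableSet_cube _ _) ?_
  filter_upwards [Lp.coeFn_sub a b] with y hy _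
  exact hy

theorem ofReal_pow_inv_mul_volume_cube {D : ℕ} {ε : ℝ} (hε : 0 < ε) (z : Fin D → ℤ) :
    ‖(ε ^ D)⁻¹‖ₑ * volume (cube ε z) = 1 := by
  have hp : 0 < ε ^ D := pow_pos hε D
  rw [volume_cube, ← ENNReal.ofReal_pow hε.le, Real.enorm_eq_ofReal (inv_nonneg.2 hp.le),
    ← ENNReal.ofReal_mul (inv_nonneg.2 hp.le), inv_mul_cancel₀ hp.ne', ENNReal.ofReal_one]

theorem lintegral_enorm_gridExp_le {D : ℕ} {ε : ℝ} (hε : 0 < ε) (a : L1 D) :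
    ∫⁻ x, ‖gridExp ε a x‖ₑ ≤ ∫⁻ x, ‖a x‖ₑ := by
  rw [← setLIntegral_univ (fun x => ‖gridExp ε a x‖ₑ), ← setLIntegral_univ (fun x => ‖a x‖ₑ),
    ← iUnion_cube (D := D) hε,
    lintegral_iUnion (fun z => measurableSet_cube ε z) (disjoint_cube hε),
    lintegral_iUnion (fun z => measurableSet_cube ε z) (disjoint_cube hε)]
  refine ENNReal.tsum_le_tsum fun z => ?_
  have h1 : ∫⁻ x in cube ε z, ‖gridExp ε a x‖ₑ =
      ∫⁻ _ in cube ε z, ‖(ε ^ D)⁻¹ * ∫ c in cube ε z, a c‖ₑ := by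
    refine setLIntegral_congr_fun (measurableSet_cube ε z) fun x hx => ?_
    simp only [gridExp, (mem_cube_iff hε x z).1 hx]
  rw [h1, setLIntegral_const, enorm_mul, mul_right_comm, ofReal_pow_inv_mul_volume_cube hε,
    one_mul]
  exact enorm_integral_le_lintegral_enorm _

theorem norm_sub_le_of_cubeIndex_eq {D : ℕ} {ε : ℝ} (hε : 0 < ε) {x y : Fin D → ℝ}
    (h : cubeIndex ε x = cubeIndex ε y) : ‖x - y‖ ≤ ε := by
  refine (pi_norm_le_iff_of_nonneg hε.le).2 fun i => ?_
  have hx := (mem_cube_iff hε x (cubeIndex ε y)).2 h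
  have hy := (mem_cube_iff hε y (cubeIndex ε y)).2 rfl
  simp only [cube, mem_univ_pi, mem_Ico] at hx hy
  rw [Pi.sub_apply, Real.norm_eq_abs, abs_le]
  constructor <;> linarith [(hx i).1, (hx i).2, (hy i).1, (hy i).2]

theorem norm_sub_gridPoint_cubeIndex_le {D : ℕ} {ε : ℝ} (hε : 0 < ε) (x : Fin D → ℝ) :
    ‖x - gridPoint ε (cubeIndex ε x)‖ ≤ ε := by
  refine (pi_norm_le_iff_of_nonneg hε.le).2 fun i => ?_
  have hx := (mem_cube_iff hε x (cubeIndex ε x)).2 rfl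
  simp only [cube, mem_univ_pi, mem_Ico] at hx
  rw [Pi.sub_apply, Real.norm_eq_abs, abs_le, gridPoint]
  constructor <;> linarith [(hx i).1, (hx i).2]

/-- The cube containing `x` lies in the sup-norm ball of radius `ε` about `x`. Enlarging it to the
ball makes the domain of the increment `h` independent of `x`, so that integrals over `x` and `h`
can be exchanged. -/
theorem enorm_gridExp_sub_le {D : ℕ} {ε : ℝ} (hε : 0 < ε) (a : L1 D) (x : Fin D → ℝ) :
    ‖gridExp ε a x - a x‖ₑ ≤
      ‖(ε ^ D)⁻¹‖ₑ * ∫⁻ h in Metric.closedBall 0 ε, ‖a (x + h) - a x‖ₑ := by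
  have hp : ε ^ D ≠ 0 := (pow_pos hε D).ne'
  have hfin : volume (cube ε (cubeIndex ε x)) ≠ ⊤ := by
    rw [volume_cube]; exact ENNReal.pow_ne_top ENNReal.ofReal_ne_top
  have hreal : volume.real (cube ε (cubeIndex ε x)) = ε ^ D := by
    rw [Measure.real, volume_cube, ENNReal.toReal_pow, ENNReal.toReal_ofReal hε.le]
  have h1 : gridExp ε a x - a x = (ε ^ D)⁻¹ * ∫ c in cube ε (cubeIndex ε x), (a c - a x) := by
    rw [integral_sub (L1.integrable_coeFn a).integrableOn (integrableOn_const hfin),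
      setIntegral_const, hreal, mul_sub, smul_eq_mul, inv_mul_cancel_left₀ hp, gridExp]
  rw [h1, enorm_mul]
  gcongr
  refine (enorm_integral_le_lintegral_enorm _).trans ?_
  rw [← lintegral_indicator (measurableSet_cube _ _),
    ← lintegral_indicator Metric.isClosed_closedBall.measurableSet,
    ← lintegral_add_left_eq_self _ x]
  refine lintegral_mono fun h => ?_
  by_cases hh : x + h ∈ cube ε (cubeIndex ε x)
  · have h2 : h ∈ Metric.closedBall (0 : Fin D → ℝ) ε := by
      have := norm_sub_le_of_cubeIndex_eq hε ((mem_cube_iff hε _ _).1 hh)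
      simpa using this
    rw [indicator_of_mem hh, indicator_of_mem h2]
  · rw [indicator_of_notMem hh]
    exact zero_le

theorem tendsto_lintegral_gridExp_sub {D : ℕ} (a : L1 D) {ε : ℕ → ℝ} (hε : ∀ n, 0 < ε n)
    (hlim : Tendsto ε atTop (𝓝 0)) :
    Tendsto (fun n => ∫⁻ x, ‖gridExp (ε n) a x - a x‖ₑ) atTop (𝓝 0) := by
  rw [ENNReal.tendsto_nhds_zero]
  intro η hη
  -- The sup-norm ball of radius `ε` has `2 ^ D` times the volume of a cube of side `ε`.
  obtain ⟨δ, hδ, H⟩ := exists_lintegral_translate_le a (η := η / 2 ^ D)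
    (ENNReal.div_pos hη.ne' (by simp))
  filter_upwards [hlim.eventually_lt_const hδ] with n hn
  have hm : Measurable (a : (Fin D → ℝ) → ℝ) := (Lp.stronglyMeasurable a).measurable
  have hvol : ‖(ε n ^ D)⁻¹‖ₑ * volume (Metric.closedBall (0 : Fin D → ℝ) (ε n)) = 2 ^ D := by
    have hp : 0 < ε n ^ D := pow_pos (hε n) D
    rw [Real.volume_pi_closedBall _ (hε n).le, Real.enorm_eq_ofReal (inv_nonneg.2 hp.le),
      ← ENNReal.ofReal_mul (inv_nonneg.2 hp.le), Fintype.card_fin, mul_pow, mul_left_comm,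
      inv_mul_cancel₀ hp.ne', mul_one, ENNReal.ofReal_pow zero_le_two, ENNReal.ofReal_ofNat]
  calc ∫⁻ x, ‖gridExp (ε n) a x - a x‖ₑ
      ≤ ∫⁻ x, ‖(ε n ^ D)⁻¹‖ₑ * ∫⁻ h in Metric.closedBall 0 (ε n), ‖a (x + h) - a x‖ₑ :=
        lintegral_mono fun x => enorm_gridExp_sub_le (hε n) a x
    _ = ‖(ε n ^ D)⁻¹‖ₑ * ∫⁻ h in Metric.closedBall 0 (ε n), ∫⁻ x, ‖a (x + h) - a x‖ₑ := by
        rw [lintegral_const_mul' _ _ enorm_ne_top, lintegral_lintegral_swap]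
        exact (((hm.comp (measurable_fst.add measurable_snd)).sub
          (hm.comp measurable_fst)).enorm).aemeasurable
    _ ≤ ‖(ε n ^ D)⁻¹‖ₑ * ∫⁻ _ in Metric.closedBall (0 : Fin D → ℝ) (ε n), η / 2 ^ D := by
        gcongr 1
        refine setLIntegral_mono' Metric.isClosed_closedBall.measurableSet fun h hh => ?_
        exact H h ((mem_closedBall_zero_iff.1 hh).trans_lt hn)
    _ = η := by
        rw [setLIntegral_const, mul_left_comm, hvol]
        exact ENNReal.div_mul_cancel (by simp) (by simp)

theorem tendsto_lintegral_gridExp {D : ℕ} {as : ℕ → L1 D} {a : L1 D}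
    (ha : Tendsto as atTop (𝓝 a)) {ε : ℕ → ℝ} (hε : ∀ n, 0 < ε n)
    (hlim : Tendsto ε atTop (𝓝 0)) :
    Tendsto (fun n => ∫⁻ x, ‖gridExp (ε n) (as n) x - a x‖ₑ) atTop (𝓝 0) := by
  have h := (tendsto_L1_iff_lintegral.1 ha).add (tendsto_lintegral_gridExp_sub a hε hlim)
  rw [add_zero] at h
  refine tendsto_of_tendsto_of_tendsto_of_le_of_le tendsto_const_nhds h (fun _ => zero_le)
    fun n => ?_
  -- The intermediate function is `𝔼_ε[a]`; contractivity of `𝔼_ε` controls the first half.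
  refine (lintegral_enorm_sub_le (integrable_gridExp (hε n) _).1
    (integrable_gridExp (hε n) a).1).trans (add_le_add_left ?_ _)
  simp only [← gridExp_sub]
  refine (lintegral_enorm_gridExp_le (hε n) _).trans (le_of_eq (lintegral_congr_ae ?_))
  filter_upwards [Lp.coeFn_sub (as n) a] with x hx
  rw [hx, Pi.sub_apply]

/-! ### The discretized convolution -/

theorem gridMass_nonneg {D : ℕ} (κ : LifeKernel D) (ε : ℝ) (z : Fin D → ℤ) :
    0 ≤ gridMass κ ε z :=
  integral_nonneg_of_ae (ae_restrict_of_ae κ.nonneg)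

theorem hasSum_gridMass {D : ℕ} (κ : LifeKernel D) {ε : ℝ} (hε : 0 < ε) :
    HasSum (gridMass κ ε) 1 := by
  have h := hasSum_integral_iUnion (fun z => measurableSet_cube ε z) (disjoint_cube (D := D) hε)
    κ.integrable.integrableOn
  rwa [iUnion_cube hε, setIntegral_univ, κ.integral_eq_one] at h

theorem sum_gridMass {D : ℕ} (κ : LifeKernel D) {ε : ℝ} (hε : 0 < ε) :
    ∑ z ∈ (finite_support_gridMass κ hε).toFinset, gridMass κ ε z = 1 :=
  (hasSum_sum_of_ne_finset_zero (by simp)).unique (hasSum_gridMass κ hε)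

/-- `κ_ε * f` is a convex combination of translates of `f`, and translations preserve the `𝐋¹`
distance. -/
theorem lintegral_enorm_gridConv_sub_le {D : ℕ} (κ : LifeKernel D) {ε : ℝ} (hε : 0 < ε)
    {f g : (Fin D → ℝ) → ℝ} (hf : Integrable f volume) (hg : Integrable g volume) :
    ∫⁻ x, ‖gridConv κ ε f x - gridConv κ ε g x‖ₑ ≤ ∫⁻ x, ‖f x - g x‖ₑ := by
  simp only [gridConv_eq_sum κ hε, ← Finset.sum_sub_distrib, ← mul_sub]
  refine (lintegral_mono fun x => enorm_sum_le _ _).trans ?_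
  have hm : ∀ z : Fin D → ℤ, AEMeasurable (fun x => ‖gridMass κ ε z *
      (f (x - gridPoint ε z) - g (x - gridPoint ε z))‖ₑ) volume := fun z =>
    (((hf.comp_sub_right _).sub (hg.comp_sub_right _)).const_mul _).1.enorm
  rw [lintegral_finsetSum' _ fun z _ => hm z]
  simp only [enorm_mul]
  have h : ∀ z : Fin D → ℤ, ∫⁻ x, ‖gridMass κ ε z‖ₑ *
      ‖f (x - gridPoint ε z) - g (x - gridPoint ε z)‖ₑ =
      ‖gridMass κ ε z‖ₑ * ∫⁻ x, ‖f x - g x‖ₑ := fun z => by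
    rw [lintegral_const_mul' _ _ enorm_ne_top,
      lintegral_sub_right_eq_self (fun x => ‖f x - g x‖ₑ)]
  rw [Finset.sum_congr rfl fun z _ => h z, ← Finset.sum_mul]
  refine mul_le_of_le_one_left zero_le (le_of_eq ?_)
  simp only [Real.enorm_eq_ofReal (gridMass_nonneg κ ε _)]
  rw [← ENNReal.ofReal_sum_of_nonneg fun z _ => gridMass_nonneg κ ε z, sum_gridMass κ hε,
    ENNReal.ofReal_one]

/-- No growth condition on `g` is needed, since `κ` charges only finitely many cubes. -/
theorem integrable_kernel_mul_comp_cubeIndex {D : ℕ} (κ : LifeKernel D) {ε : ℝ} (hε : 0 < ε)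
    (g : (Fin D → ℤ) → ℝ) : Integrable (fun y => κ.toFun y * g (cubeIndex ε y)) volume := by
  rw [← integrableOn_univ, ← iUnion_cube hε]
  have hcongr : ∀ z, EqOn (fun y => κ.toFun y * g z) (fun y => κ.toFun y * g (cubeIndex ε y))
      (cube ε z) := fun z y hy => by simp only [(mem_cube_iff hε y z).1 hy]
  refine integrableOn_iUnion_of_summable_integral_norm (fun z => ?_) ?_
  · exact ((κ.integrable.mul_const (g z)).integrableOn).congr_fun (hcongr z)
      (measurableSet_cube ε z)
  · refine summable_of_hasFiniteSupport ((finite_support_gridMass κ hε).subset fun z hz => ?_)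
    -- As `κ ≥ 0`, a cube of zero mass contributes nothing to the integral of the norm either.
    contrapose! hz
    rw [Function.notMem_support] at hz ⊢
    have h1 : ∫ y in cube ε z, ‖κ.toFun y * g (cubeIndex ε y)‖ =
        ∫ y in cube ε z, κ.toFun y * ‖g z‖ := by
      refine setIntegral_congr_ae (measurableSet_cube ε z) ?_
      filter_upwards [κ.nonneg] with y hy hyz
      rw [norm_mul, Real.norm_of_nonneg hy, (mem_cube_iff hε y z).1 hyz]
    rw [h1, integral_mul_const]
    change gridMass κ ε z * _ = 0
    rw [hz, zero_mul]

/-- `κ_ε` is the image of `κ` under moving each point to the centre of its cube. This form allows a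
comparison with `κ * f` under one integral, where the two arguments of `f` differ by at most `ε`. -/
theorem gridConv_eq_integral {D : ℕ} (κ : LifeKernel D) {ε : ℝ} (hε : 0 < ε)
    (f : (Fin D → ℝ) → ℝ) (x : Fin D → ℝ) :
    gridConv κ ε f x = ∫ y, κ.toFun y * f (x - gridPoint ε (cubeIndex ε y)) := by
  have h := integral_iUnion (fun z => measurableSet_cube ε z) (disjoint_cube (D := D) hε)
    (integrable_kernel_mul_comp_cubeIndex κ hε fun z => f (x - gridPoint ε z)).integrableOn
  rw [iUnion_cube hε, setIntegral_univ] at h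
  rw [h]
  refine tsum_congr fun z => ?_
  rw [gridMass, ← integral_mul_const]
  refine setIntegral_congr_fun (measurableSet_cube ε z) fun y hy => ?_
  simp only [(mem_cube_iff hε y z).1 hy]

theorem tendsto_lintegral_gridConv_sub_conv {D : ℕ} (κ : LifeKernel D) (a : L1 D) {ε : ℕ → ℝ}
    (hε : ∀ n, 0 < ε n) (hlim : Tendsto ε atTop (𝓝 0)) :
    Tendsto (fun n => ∫⁻ x, ‖gridConv κ (ε n) a x - conv κ a x‖ₑ) atTop (𝓝 0) := by
  rw [ENNReal.tendsto_nhds_zero]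
  intro η hη
  obtain ⟨δ, hδ, H⟩ := exists_lintegral_translate_le a hη
  filter_upwards [hlim.eventually_lt_const hδ] with n hn
  have hm : Measurable (a : (Fin D → ℝ) → ℝ) := (Lp.stronglyMeasurable a).measurable
  have hidx : Measurable fun y : Fin D → ℝ => gridPoint (ε n) (cubeIndex (ε n) y) :=
    (measurable_of_countable (gridPoint (ε n))).comp
      ((measurable_cubeIndex (hε n)).mono (gridSigma_le (ε n)) le_rfl)
  have hκ : ∫⁻ y, ‖κ.toFun y‖ₑ = 1 := by
    rw [← ofReal_integral_norm_eq_lintegral_enorm κ.integrable, integral_congr_ae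
      (κ.nonneg.mono fun y hy => Real.norm_of_nonneg hy), κ.integral_eq_one, ENNReal.ofReal_one]
  -- Up to a change of variable, the two functions are translates of `a` by vectors at distance at
  -- most `ε n < δ`.
  have key : ∀ y, ∫⁻ x, ‖a (x - gridPoint (ε n) (cubeIndex (ε n) y)) - a (x - y)‖ₑ ≤ η := by
    intro y
    have h1 := H (y - gridPoint (ε n) (cubeIndex (ε n) y))
      ((norm_sub_gridPoint_cubeIndex_le (hε n) y).trans_lt hn)
    rw [← lintegral_sub_right_eq_self _ y] at h1
    simpa only [sub_add_sub_cancel] using h1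
  calc ∫⁻ x, ‖gridConv κ (ε n) a x - conv κ a x‖ₑ
      ≤ ∫⁻ x, ∫⁻ y, ‖κ.toFun y‖ₑ *
          ‖a (x - gridPoint (ε n) (cubeIndex (ε n) y)) - a (x - y)‖ₑ := by
        refine lintegral_mono_ae ?_
        filter_upwards [κ.integrable.ae_convolution_exists (ContinuousLinearMap.mul ℝ ℝ)
          (L1.integrable_coeFn a)] with x hx
        have h2 : gridConv κ (ε n) a x - conv κ a x = ∫ y, κ.toFun y *
            (a (x - gridPoint (ε n) (cubeIndex (ε n) y)) - a (x - y)) := by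
          rw [gridConv_eq_integral κ (hε n)]
          simp only [mul_sub]
          rw [integral_sub]
          · rfl
          · exact integrable_kernel_mul_comp_cubeIndex κ (hε n)
              fun z => a (x - gridPoint (ε n) z)
          · exact hx.integrable
        rw [h2]
        refine (enorm_integral_le_lintegral_enorm _).trans (le_of_eq ?_)
        simp only [enorm_mul]
    _ = ∫⁻ y, ‖κ.toFun y‖ₑ *
          ∫⁻ x, ‖a (x - gridPoint (ε n) (cubeIndex (ε n) y)) - a (x - y)‖ₑ := by
        rw [lintegral_lintegral_swap]
        · refine lintegral_congr fun y => lintegral_const_mul' _ _ enorm_ne_top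
        · have h3 : AEMeasurable (fun p : (Fin D → ℝ) × (Fin D → ℝ) => ‖κ.toFun p.2‖ₑ)
              (volume.prod volume) := κ.integrable.1.enorm.comp_snd
          refine h3.mul ?_
          exact (((hm.comp (measurable_fst.sub (hidx.comp measurable_snd))).sub
            (hm.comp (measurable_fst.sub measurable_snd))).enorm).aemeasurable
    _ ≤ ∫⁻ y, ‖κ.toFun y‖ₑ * η := by
        gcongr with y
        exact key y
    _ = η := by rw [lintegral_mul_const'' _ κ.integrable.1.enorm, hκ, one_mul]

theorem tendsto_lintegral_gridConv {D : ℕ} (κ : LifeKernel D) {as : ℕ → L1 D} {a : L1 D}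
    (ha : Tendsto as atTop (𝓝 a)) {ε : ℕ → ℝ} (hε : ∀ n, 0 < ε n)
    (hlim : Tendsto ε atTop (𝓝 0)) :
    Tendsto (fun n => ∫⁻ x, ‖gridConv κ (ε n) (gridExp (ε n) (as n)) x - conv κ a x‖ₑ)
      atTop (𝓝 0) := by
  have h := (tendsto_lintegral_gridExp ha hε hlim).add
    (tendsto_lintegral_gridConv_sub_conv κ a hε hlim)
  rw [add_zero] at h
  refine tendsto_of_tendsto_of_tendsto_of_le_of_le tendsto_const_nhds h (fun _ => zero_le)
    fun n => ?_
  have hE := integrable_gridExp (hε n) (as n)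
  have hA := L1.integrable_coeFn a
  exact (lintegral_enorm_sub_le (integrable_gridConv κ (hε n) hE).1
    (integrable_gridConv κ (hε n) hA).1).trans
    (add_le_add_left (lintegral_enorm_gridConv_sub_le κ (hε n) hE hA) _)

/-! ### Convergence of the discretized automata -/

theorem continuousAt_indicator_Icc_one {u v β : ℝ} (hu : β ≠ u) (hv : β ≠ v) :
    ContinuousAt ((Icc u v).indicator (1 : ℝ → ℝ)) β := by
  rcases lt_or_gt_of_ne hu with h | h
  · refine (continuousAt_const (X := ℝ) (y := (0 : ℝ))).congr ?_
    filter_upwards [eventually_lt_nhds h] with x hx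
    exact (indicator_of_notMem (fun hm => hx.not_ge hm.1) _).symm
  rcases lt_or_gt_of_ne hv with h' | h'
  · refine (continuousAt_const (X := ℝ) (y := (1 : ℝ))).congr ?_
    filter_upwards [eventually_lt_nhds h', eventually_gt_nhds h] with x hx hx'
    have hm : x ∈ Icc u v := ⟨hx'.le, hx.le⟩
    exact (indicator_of_mem hm (1 : ℝ → ℝ)).symm
  · refine (continuousAt_const (X := ℝ) (y := (0 : ℝ))).congr ?_
    filter_upwards [eventually_gt_nhds h'] with x hx
    exact (indicator_of_notMem (fun hm => hx.not_ge hm.2) _).symm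

theorem abs_indicator_one_sub_le_one (s : Set ℝ) (α β : ℝ) :
    |s.indicator (1 : ℝ → ℝ) α - s.indicator 1 β| ≤ 1 := by
  by_cases hα : α ∈ s <;> by_cases hβ : β ∈ s <;> simp [hα, hβ]

/-- A Markov-type bound: if either indicator is nonzero, then `|β| + |α - β| ≥ u`. It replaces the
non-integrable bound `1`. -/
theorem abs_indicator_Icc_sub_le {u v : ℝ} (hu : 0 < u) (α β : ℝ) :
    |(Icc u v).indicator (1 : ℝ → ℝ) α - (Icc u v).indicator 1 β| ≤
      u⁻¹ * |β| + u⁻¹ * |α - β| := by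
  have h1 : |α| ≤ |β| + |α - β| := by
    have := abs_add_le β (α - β)
    rwa [add_sub_cancel] at this
  rw [← mul_add, inv_mul_eq_div]
  by_cases hα : α ∈ Icc u v
  · refine (abs_indicator_one_sub_le_one _ _ _).trans ((one_le_div hu).2 ?_)
    exact (hα.1.trans (le_abs_self α)).trans h1
  by_cases hβ : β ∈ Icc u v
  · refine (abs_indicator_one_sub_le_one _ _ _).trans ((one_le_div hu).2 ?_)
    linarith [hβ.1.trans (le_abs_self β), abs_nonneg (α - β)]
  · simp only [indicator_of_notMem hα, indicator_of_notMem hβ, sub_self, abs_zero]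
    positivity

/-- The part of the variation of `lifeRule θ t` between `α` and `β` that is due to crossing the
thresholds. -/
noncomputable def thresholdGap (θ : Thresholds) (t α β : ℝ) : ℝ :=
  |t| * (|(Icc θ.s₀ θ.s₁).indicator (1 : ℝ → ℝ) α - (Icc θ.s₀ θ.s₁).indicator 1 β| +
    |(Icc θ.b₀ θ.b₁).indicator (1 : ℝ → ℝ) α - (Icc θ.b₀ θ.b₁).indicator 1 β|) +
    |(Icc θ.b₀ θ.b₁).indicator (1 : ℝ → ℝ) α - (Icc θ.b₀ θ.b₁).indicator 1 β|

theorem Thresholds.b₀_pos (θ : Thresholds) : 0 < θ.b₀ := θ.s₀_pos.trans_le θ.s₀_le_b₀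

theorem thresholdGap_nonneg (θ : Thresholds) (t α β : ℝ) : 0 ≤ thresholdGap θ t α β := by
  unfold thresholdGap; positivity

/-- Splits the gap into a part dominated by a function of `t` and `β` alone, fit for dominated
convergence, and a remainder that is small in `𝐋¹` when `α` is close to `β`. -/
theorem thresholdGap_le (θ : Thresholds) (t α β : ℝ) :
    thresholdGap θ t α β ≤
      min (thresholdGap θ t α β) (2 * |t| + θ.b₀⁻¹ * |β|) + θ.b₀⁻¹ * |α - β| := by
  have hb := inv_nonneg.2 θ.b₀_pos.le
  have h0 : 0 ≤ θ.b₀⁻¹ * |α - β| := mul_nonneg hb (abs_nonneg _)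
  rcases min_choice (thresholdGap θ t α β) (2 * |t| + θ.b₀⁻¹ * |β|) with h | h <;> rw [h]
  · exact le_add_of_nonneg_right h0
  · have h1 := abs_indicator_one_sub_le_one (Icc θ.s₀ θ.s₁) α β
    have h2 := abs_indicator_one_sub_le_one (Icc θ.b₀ θ.b₁) α β
    have h3 := abs_indicator_Icc_sub_le (v := θ.b₁) θ.b₀_pos α β
    have h4 := mul_le_mul_of_nonneg_left (add_le_add h1 h2) (abs_nonneg t)
    unfold thresholdGap
    linarith

theorem abs_lifeRule_sub_le (θ : Thresholds) (f t α β : ℝ) :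
    |lifeRule θ f α - lifeRule θ t β| ≤ 2 * |f - t| + thresholdGap θ t α β := by
  unfold lifeRule thresholdGap
  set s := (Icc θ.s₀ θ.s₁).indicator (1 : ℝ → ℝ) with hs
  set b := (Icc θ.b₀ θ.b₁).indicator (1 : ℝ → ℝ) with hb
  have h1 : |s α - b α| ≤ 2 := by
    have h3 : |s α| ≤ 1 := by by_cases h : α ∈ Icc θ.s₀ θ.s₁ <;> simp [hs, h]
    have h4 : |b α| ≤ 1 := by by_cases h : α ∈ Icc θ.b₀ θ.b₁ <;> simp [hb, h]
    linarith [abs_sub (s α) (b α)]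
  -- The state changes first, at fixed density `α`; then the density changes, at fixed state `t`.
  have h2 : f * s α + (1 - f) * b α - (t * s β + (1 - t) * b β) =
      (f - t) * (s α - b α) + (t * ((s α - s β) - (b α - b β)) + (b α - b β)) := by ring
  rw [h2]
  refine (abs_add_le _ _).trans (add_le_add ?_ ((abs_add_le _ _).trans (add_le_add_left ?_ _)))
  · rw [abs_mul, mul_comm]
    exact mul_le_mul_of_nonneg_right h1 (abs_nonneg _)
  · rw [abs_mul]
    exact mul_le_mul_of_nonneg_left (abs_sub _ _) (abs_nonneg t)

theorem measurable_thresholdGap (θ : Thresholds) :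
    Measurable (fun p : ℝ × ℝ × ℝ => thresholdGap θ p.1 p.2.1 p.2.2) := by
  have hs : Measurable ((Icc θ.s₀ θ.s₁).indicator (1 : ℝ → ℝ)) :=
    measurable_one.indicator measurableSet_Icc
  have hb : Measurable ((Icc θ.b₀ θ.b₁).indicator (1 : ℝ → ℝ)) :=
    measurable_one.indicator measurableSet_Icc
  unfold thresholdGap
  fun_prop

theorem tendsto_thresholdGap {θ : Thresholds} {β : ℝ} (hβ : β ∉ ({θ.s₀, θ.b₀, θ.s₁, θ.b₁} : Set ℝ))
    (t : ℝ) : Tendsto (fun α => thresholdGap θ t α β) (𝓝 β) (𝓝 0) := by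
  simp only [mem_insert_iff, mem_singleton_iff, not_or] at hβ
  have hs := (continuousAt_indicator_Icc_one (u := θ.s₀) (v := θ.s₁) hβ.1 hβ.2.2.1)
  have hb := (continuousAt_indicator_Icc_one (u := θ.b₀) (v := θ.b₁) hβ.2.1 hβ.2.2.2)
  have h : ContinuousAt (fun α => thresholdGap θ t α β) β := by
    unfold thresholdGap
    fun_prop
  have h0 : thresholdGap θ t β β = 0 := by simp [thresholdGap]
  simpa [ContinuousAt, h0] using h

theorem tendsto_lintegral_lifeRule {X : Type*} [MeasurableSpace X] {μ : Measure X}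
    (θ : Thresholds) {f α : ℕ → X → ℝ} {t β : X → ℝ}
    (hf : ∀ n, Integrable (f n) μ) (hα : ∀ n, Integrable (α n) μ)
    (ht : Integrable t μ) (hβ : Integrable β μ)
    (hft : Tendsto (fun n => ∫⁻ x, ‖f n x - t x‖ₑ ∂μ) atTop (𝓝 0))
    (hαβ : Tendsto (fun n => ∫⁻ x, ‖α n x - β x‖ₑ ∂μ) atTop (𝓝 0))
    (hreg : ∀ᵐ x ∂μ, β x ∉ ({θ.s₀, θ.b₀, θ.s₁, θ.b₁} : Set ℝ)) :
    Tendsto (fun n => ∫⁻ x, ‖lifeRule θ (f n x) (α n x) - lifeRule θ (t x) (β x)‖ₑ ∂μ)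
      atTop (𝓝 0) := by
  let B : X → ℝ := fun x => 2 * |t x| + θ.b₀⁻¹ * |β x|
  let m : ℕ → X → ℝ := fun n x => min (thresholdGap θ (t x) (α n x) (β x)) (B x)
  have hBint : Integrable B μ := (ht.abs.const_mul 2).add (hβ.abs.const_mul _)
  have hB : ∀ x, 0 ≤ B x := fun x => by
    have := inv_nonneg.2 θ.b₀_pos.le
    positivity
  have hm0 : ∀ n x, 0 ≤ m n x := fun n x => le_min (thresholdGap_nonneg θ _ _ _) (hB x)
  have hmm : ∀ n, AEMeasurable (m n) μ := fun n =>
    AEMeasurable.min ((measurable_thresholdGap θ).comp_aemeasurable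
      (ht.aemeasurable.prodMk ((hα n).aemeasurable.prodMk hβ.aemeasurable))) hBint.aemeasurable
  have hgap : Tendsto (fun n => ∫⁻ x, ‖m n x‖ₑ ∂μ) atTop (𝓝 0) := by
    -- `𝐋¹` convergence of the densities yields almost everywhere convergence only along
    -- subsequences, which suffices since the limit is the same for all of them.
    refine tendsto_of_subseq_tendsto fun ns hns => ?_
    have hmeas : TendstoInMeasure μ (fun k => α (ns k)) atTop β := by
      refine tendstoInMeasure_of_tendsto_eLpNorm one_ne_zero (fun k => (hα (ns k)).1) hβ.1 ?_
      simp only [eLpNorm_one_eq_lintegral_enorm, Pi.sub_apply]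
      exact hαβ.comp hns
    obtain ⟨ms, -, hms⟩ := hmeas.exists_seq_tendsto_ae
    refine ⟨ms, ?_⟩
    have h := tendsto_lintegral_of_dominated_convergence' (μ := μ)
      (F := fun k x => ‖m (ns (ms k)) x‖ₑ) (f := fun _ => 0) (fun x => ‖B x‖ₑ)
      (fun k => (hmm _).enorm) (fun k => Eventually.of_forall fun x => ?_) hBint.2.ne ?_
    · simpa using h
    · simp only
      rw [Real.enorm_eq_ofReal (hm0 _ x), Real.enorm_eq_ofReal (hB x)]
      exact ENNReal.ofReal_le_ofReal (min_le_right _ _)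
    · filter_upwards [hms, hreg] with x hx hx'
      have h1 := ((tendsto_thresholdGap hx' (t x)).comp hx).min
        (tendsto_const_nhds (x := B x))
      rw [min_eq_left (hB x)] at h1
      simpa using h1.enorm
  -- The coefficients `2` and `b₀⁻¹` come from `abs_lifeRule_sub_le` and `thresholdGap_le`.
  have hsum := ((ENNReal.Tendsto.const_mul (a := 2) hft (Or.inr ENNReal.ofNat_ne_top)).add hgap).add
    (ENNReal.Tendsto.const_mul (a := ENNReal.ofReal θ.b₀⁻¹) hαβ (Or.inr ENNReal.ofReal_ne_top))
  simp only [mul_zero, add_zero] at hsum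
  refine tendsto_of_tendsto_of_tendsto_of_le_of_le tendsto_const_nhds hsum (fun _ => zero_le)
    fun n => ?_
  have h1 : AEMeasurable (fun x => 2 * ‖f n x - t x‖ₑ) μ :=
    ((hf n).sub ht).1.enorm.const_mul 2
  have h2 : AEMeasurable (fun x => 2 * ‖f n x - t x‖ₑ + ‖m n x‖ₑ) μ := h1.add (hmm n).enorm
  rw [← lintegral_const_mul' _ _ ENNReal.ofNat_ne_top,
    ← lintegral_const_mul' _ _ ENNReal.ofReal_ne_top, ← lintegral_add_left' h1,
    ← lintegral_add_left' h2]
  refine lintegral_mono fun x => ?_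
  have h3 : |lifeRule θ (f n x) (α n x) - lifeRule θ (t x) (β x)| ≤
      2 * |f n x - t x| + m n x + θ.b₀⁻¹ * |α n x - β x| := by
    have h4 := abs_lifeRule_sub_le θ (f n x) (t x) (α n x) (β x)
    have h5 := thresholdGap_le θ (t x) (α n x) (β x)
    simp only [m, B]
    linarith
  have hb := inv_nonneg.2 θ.b₀_pos.le
  simp only [Real.enorm_eq_ofReal_abs, abs_of_nonneg (hm0 n x)]
  rw [← ENNReal.ofReal_ofNat 2, ← ENNReal.ofReal_mul zero_le_two, ← ENNReal.ofReal_mul hb,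
    ← ENNReal.ofReal_add (by positivity) (hm0 n x),
    ← ENNReal.ofReal_add (add_nonneg (by positivity) (hm0 n x)) (by positivity)]
  exact ENNReal.ofReal_le_ofReal h3

/-! ### Continuous convergence at regular configurations -/

theorem coeFn_realLife {D : ℕ} (θ : Thresholds) (κ : LifeKernel D) (a : L1 D) :
    (realLife θ κ a : (Fin D → ℝ) → ℝ) =ᵐ[volume] fun x => lifeRule θ (a x) (conv κ a x) :=
  MemLp.coeFn_toLp _

theorem coeFn_discreteLife {D : ℕ} (θ : Thresholds) (κ : LifeKernel D) {ε : ℝ} (hε : 0 < ε)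
    (a : L1 D) : ((discreteLife θ κ ε hε a : L1 D) : (Fin D → ℝ) → ℝ) =ᵐ[volume]
      fun x => lifeRule θ (gridExp ε a x) (gridConv κ ε (gridExp ε a) x) :=
  MemLp.coeFn_toLp (memLp_one_iff_integrable.2 (integrable_lifeRule θ (integrable_gridExp hε a)
    (integrable_gridConv κ hε (integrable_gridExp hε a))))

theorem tendsto_discreteLife {D : ℕ} (θ : Thresholds) (κ : LifeKernel D) {as : ℕ → L1 D}
    {a : L1 D} (ha : a ∈ regularConfigs θ κ) (has : Tendsto as atTop (𝓝 a)) {ε : ℕ → ℝ}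
    (hε : ∀ n, 0 < ε n) (hlim : Tendsto ε atTop (𝓝 0)) :
    Tendsto (fun n => (discreteLife θ κ (ε n) (hε n) (as n) : L1 D)) atTop
      (𝓝 (realLife θ κ a)) := by
  rw [tendsto_L1_iff_lintegral]
  have h := tendsto_lintegral_lifeRule θ (fun n => integrable_gridExp (hε n) (as n))
    (fun n => integrable_gridConv κ (hε n) (integrable_gridExp (hε n) (as n)))
    (L1.integrable_coeFn a) (integrable_conv κ a) (tendsto_lintegral_gridExp has hε hlim)
    (tendsto_lintegral_gridConv κ has hε hlim) (measure_eq_zero_iff_ae_notMem.1 ha.2)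
  refine h.congr fun n => lintegral_congr_ae ?_
  filter_upwards [coeFn_realLife θ κ a, coeFn_discreteLife θ κ (hε n) (as n)] with x hx hx'
  rw [hx, hx']

theorem tendsto_discreteLife_nhds_zero {D : ℕ} (θ : Thresholds) (κ : LifeKernel D) {a : L1 D}
    (ha : a ∈ regularConfigs θ κ) :
    Tendsto (fun ε : Ioi (0 : ℝ) => (discreteLife θ κ (ε : ℝ) ε.2 a : L1 D))
      (comap (fun ε : Ioi (0 : ℝ) => (ε : ℝ)) (𝓝 0)) (𝓝 (realLife θ κ a)) := by
  refine tendsto_of_seq_tendsto fun ε hε => ?_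
  exact tendsto_discreteLife θ κ ha tendsto_const_nhds (fun n => (ε n).2)
    (tendsto_comap_iff.1 hε)

/-! ### Evolution of life forms -/

theorem conv_shift {D : ℕ} (κ : LifeKernel D) (v : Fin D → ℝ) (a : L1 D) (x : Fin D → ℝ) :
    conv κ (shift v a) x = conv κ a (x + v) := by
  refine integral_congr_ae ?_
  have h := (quasiMeasurePreserving_sub_left_of_right_invariant (volume : Measure (Fin D → ℝ))
    x).ae (coeFn_shift v a)
  filter_upwards [h] with y hy
  rw [hy, sub_add_eq_add_sub]

theorem shift_mem_regularConfigs {D : ℕ} {θ : Thresholds} {κ : LifeKernel D} {a : L1 D}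
    (ha : a ∈ regularConfigs θ κ) (v : Fin D → ℝ) : shift v a ∈ regularConfigs θ κ := by
  constructor
  · have h := (measurePreserving_add_right volume v).quasiMeasurePreserving.ae ha.1
    change ∀ᵐ x, _
    filter_upwards [h, coeFn_shift v a] with x hx hx'
    rwa [hx']
  · have h : conv κ (shift v a) = fun x => conv κ a (x + v) := funext (conv_shift κ v a)
    have h2 := measure_preimage_add_right volume v (conv κ a ⁻¹' {θ.s₀, θ.b₀, θ.s₁, θ.b₁})
    rw [ha.2] at h2
    rw [h]
    exact h2

/-- Continuous convergence composes. Only the limit orbit must stay in `A`, and only before time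
`P`; the approximating orbits are unconstrained. -/
theorem tendsto_iterate_of_forall {X : Type*} [TopologicalSpace X] {Φs : ℕ → X → X} {Φ : X → X}
    {A : Set X} (hΦ : ∀ (as : ℕ → X), ∀ a ∈ A, Tendsto as atTop (𝓝 a) →
      Tendsto (fun n => Φs n (as n)) atTop (𝓝 (Φ a)))
    {as : ℕ → X} {a : X} (has : Tendsto as atTop (𝓝 a)) (P : ℕ) (hP : ∀ p < P, Φ^[p] a ∈ A) :
    Tendsto (fun n => (Φs n)^[P] (as n)) atTop (𝓝 (Φ^[P] a)) := by
  induction P with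
  | zero => exact has
  | succ P ih =>
    simp only [Function.iterate_succ_apply']
    exact hΦ _ _ (hP P P.lt_succ_self) (ih fun p hp => hP p (hp.trans P.lt_succ_self))

theorem evolvesOn_of_tendsto {D : ℕ} {Φs : ℕ → L1 D → L1 D} {Φ : L1 D → L1 D} {A : Set (L1 D)}
    (hA : ∀ (v : Fin D → ℝ), ∀ a ∈ A, shift v a ∈ A)
    (hΦ : ∀ (as : ℕ → L1 D), ∀ a ∈ A, Tendsto as atTop (𝓝 a) →
      Tendsto (fun n => Φs n (as n)) atTop (𝓝 (Φ a))) : EvolvesOn Φs Φ A where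
  shift_invariant := hA
  stillLife _ _ ha has h :=
    tendsto_nhds_unique ((hΦ _ _ ha has).congr h) has
  oscillator _ _ _ has P _ hP h :=
    tendsto_nhds_unique ((tendsto_iterate_of_forall hΦ has P hP).congr h) has
  bug _ _ _ has P _ hP _ _ hv h :=
    tendsto_nhds_unique ((tendsto_iterate_of_forall hΦ has P hP).congr h)
      (tendsto_shift has (hv.const_smul (P : ℝ)))

/-! ### The isomorphism with Larger than Life automata -/

/-- The average of `a` over the cube with index `z`. -/
noncomputable def gridAverage {D : ℕ} (ε : ℝ) (a : L1 D) (z : Fin D → ℤ) : ℝ :=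
  (ε ^ D)⁻¹ * ∫ c in cube ε z, a c

theorem volume_real_cube {D : ℕ} {ε : ℝ} (hε : 0 < ε) (z : Fin D → ℤ) :
    volume.real (cube ε z) = ε ^ D := by
  rw [Measure.real, volume_cube, ENNReal.toReal_pow, ENNReal.toReal_ofReal hε.le]

theorem volume_cube_ne_top {D : ℕ} (ε : ℝ) (z : Fin D → ℤ) : volume (cube ε z) ≠ ⊤ := by
  rw [volume_cube]; exact ENNReal.pow_ne_top ENNReal.ofReal_ne_top

theorem volume_cube_ne_zero {D : ℕ} {ε : ℝ} (hε : 0 < ε) (z : Fin D → ℤ) :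
    volume (cube ε z) ≠ 0 := by
  rw [volume_cube]; exact pow_ne_zero _ (ENNReal.ofReal_pos.2 hε).ne'

theorem gridAverage_add {D : ℕ} (ε : ℝ) (a b : L1 D) :
    gridAverage ε (a + b) = gridAverage ε a + gridAverage ε b := by
  funext z
  simp only [gridAverage, Pi.add_apply]
  rw [← mul_add, ← integral_add (L1.integrable_coeFn a).integrableOn
    (L1.integrable_coeFn b).integrableOn]
  congr 1
  refine setIntegral_congr_ae (measurableSet_cube _ _) ?_
  filter_upwards [Lp.coeFn_add a b] with y hy _
  exact hy

theorem gridAverage_smul {D : ℕ} (ε c : ℝ) (a : L1 D) :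
    gridAverage ε (c • a) = c • gridAverage ε a := by
  funext z
  have h : ∫ y in cube ε z, (c • a) y = ∫ y in cube ε z, c * a y := by
    refine setIntegral_congr_ae (measurableSet_cube _ _) ?_
    filter_upwards [Lp.coeFn_smul c a] with y hy _
    exact hy
  rw [Pi.smul_apply, smul_eq_mul, gridAverage, gridAverage, h, integral_const_mul, mul_left_comm]

theorem gridAverage_eq_of_ae_eq {D : ℕ} {ε : ℝ} (hε : 0 < ε) {a : L1 D}
    {F : (Fin D → ℤ) → ℝ} (h : (a : (Fin D → ℝ) → ℝ) =ᵐ[volume] fun x => F (cubeIndex ε x)) :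
    gridAverage ε a = F := by
  funext z
  have h1 : ∫ c in cube ε z, a c = ∫ _ in cube ε z, F z := by
    refine setIntegral_congr_ae (measurableSet_cube _ _) ?_
    filter_upwards [h] with y hy hyz
    rw [hy, (mem_cube_iff hε y z).1 hyz]
  rw [gridAverage, h1, setIntegral_const, volume_real_cube hε, smul_eq_mul,
    inv_mul_cancel_left₀ (pow_pos hε D).ne']

theorem gridSigma_le_comap {D : ℕ} {ε : ℝ} (hε : 0 < ε) :
    gridSigma D ε ≤ MeasurableSpace.comap (cubeIndex ε) inferInstance := by
  refine MeasurableSpace.generateFrom_le ?_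
  rintro _ ⟨z, rfl⟩
  refine ⟨{z}, measurableSet_singleton z, ?_⟩
  ext x
  simp [mem_cube_iff hε]

/-- Doob–Dynkin: a `ℬ_ε`-measurable representative is a function of the cube index, and averaging
recovers that function. -/
theorem GridL1.ae_eq_gridAverage {D : ℕ} {ε : ℝ} (hε : 0 < ε) (a : GridL1 D ε) :
    ((a : L1 D) : (Fin D → ℝ) → ℝ) =ᵐ[volume]
      fun x => gridAverage ε (a : L1 D) (cubeIndex ε x) := by
  obtain ⟨g, hg, hag⟩ := mem_lpMeas_iff_aestronglyMeasurable.1 a.2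
  have hgm : Measurable[MeasurableSpace.comap (cubeIndex (D := D) ε) inferInstance] g :=
    hg.measurable.mono (gridSigma_le_comap hε) le_rfl
  obtain ⟨F, -, rfl⟩ := hgm.exists_eq_measurable_comp
  rwa [gridAverage_eq_of_ae_eq hε hag]

/-! ### Integrability of step functions and summability of their values -/

theorem setIntegral_norm_comp_cubeIndex {D : ℕ} {ε : ℝ} (hε : 0 < ε) (F : (Fin D → ℤ) → ℝ)
    (z : Fin D → ℤ) : ∫ x in cube ε z, ‖F (cubeIndex ε x)‖ = ε ^ D * ‖F z‖ := by
  have h : ∫ x in cube ε z, ‖F (cubeIndex ε x)‖ = ∫ _ in cube ε z, ‖F z‖ :=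
    setIntegral_congr_fun (measurableSet_cube ε z) fun y hy => by
      simp only [(mem_cube_iff hε y z).1 hy]
  rw [h, setIntegral_const, volume_real_cube hε, smul_eq_mul]

theorem hasSum_norm_of_integrable_comp_cubeIndex {D : ℕ} {ε : ℝ} (hε : 0 < ε)
    {F : (Fin D → ℤ) → ℝ}
    (hF : Integrable (fun x => F (cubeIndex ε x)) (volume : Measure (Fin D → ℝ))) :
    HasSum (fun z => ε ^ D * ‖F z‖) (∫ x, ‖F (cubeIndex ε x)‖) := by
  have h := hasSum_integral_iUnion (fun z => measurableSet_cube ε z) (disjoint_cube (D := D) hε)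
    hF.norm.integrableOn
  simpa only [iUnion_cube hε, setIntegral_univ, setIntegral_norm_comp_cubeIndex hε] using h

theorem integrable_comp_cubeIndex {D : ℕ} {ε : ℝ} (hε : 0 < ε) {F : (Fin D → ℤ) → ℝ}
    (hF : Summable fun z => ‖F z‖) :
    Integrable (fun x => F (cubeIndex ε x)) (volume : Measure (Fin D → ℝ)) := by
  rw [← integrableOn_univ, ← iUnion_cube hε]
  refine integrableOn_iUnion_of_summable_integral_norm (fun z => ?_) ?_
  · exact (integrableOn_const (C := F z) (volume_cube_ne_top ε z)).congr_fun
      (fun y hy => by simp only [(mem_cube_iff hε y z).1 hy]) (measurableSet_cube ε z)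
  · simpa only [setIntegral_norm_comp_cubeIndex hε] using hF.mul_left (ε ^ D)

theorem GridL1.hasSum_norm_gridAverage {D : ℕ} {ε : ℝ} (hε : 0 < ε) (a : GridL1 D ε) :
    HasSum (fun z => ε ^ D * ‖gridAverage ε (a : L1 D) z‖) ‖a‖ := by
  have h := GridL1.ae_eq_gridAverage hε a
  have h1 := hasSum_norm_of_integrable_comp_cubeIndex hε
    ((L1.integrable_coeFn (a : L1 D)).congr h)
  have h2 : ‖a‖ = ∫ x, ‖gridAverage ε (a : L1 D) (cubeIndex ε x)‖ :=
    (L1.norm_eq_integral_norm (a : L1 D)).trans (integral_congr_ae (h.fun_comp norm))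
  rwa [← h2] at h1

theorem GridL1.summable_norm_gridAverage {D : ℕ} {ε : ℝ} (hε : 0 < ε) (a : GridL1 D ε) :
    Summable fun z => ‖gridAverage ε (a : L1 D) z‖ :=
  (summable_mul_left_iff (pow_pos hε D).ne').1 (GridL1.hasSum_norm_gridAverage hε a).summable

theorem SeqL1.summable_norm {D : ℕ} (u : SeqL1 D) : Summable fun z => ‖u z‖ := by
  simpa using (memℓp_gen_iff (by simp)).1 (lp.memℓp u)

theorem SeqL1.norm_eq_tsum {D : ℕ} (u : SeqL1 D) : ‖u‖ = ∑' z, ‖u z‖ := by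
  simpa using lp.norm_eq_tsum_rpow (by simp) u

/-- The element of `𝐋¹_ε` with prescribed summable values on the cubes. -/
noncomputable def gridFunction {D : ℕ} {ε : ℝ} (hε : 0 < ε) (u : SeqL1 D) : GridL1 D ε :=
  ⟨(memLp_one_iff_integrable.2 (integrable_comp_cubeIndex hε (SeqL1.summable_norm u))).toLp
      (fun x => u (cubeIndex ε x)),
    mem_lpMeas_iff_aestronglyMeasurable.2
      ⟨fun x => u (cubeIndex ε x),
        ((measurable_of_countable (u : (Fin D → ℤ) → ℝ)).comp
          (measurable_cubeIndex hε)).stronglyMeasurable,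
        MemLp.coeFn_toLp _⟩⟩

theorem coeFn_gridFunction {D : ℕ} {ε : ℝ} (hε : 0 < ε) (u : SeqL1 D) :
    ((gridFunction hε u : L1 D) : (Fin D → ℝ) → ℝ) =ᵐ[volume] fun x => u (cubeIndex ε x) :=
  MemLp.coeFn_toLp (memLp_one_iff_integrable.2
    (integrable_comp_cubeIndex hε (SeqL1.summable_norm u)))

/-- Sampling on the cubes, as a linear equivalence `𝐋¹_ε ≃ ℓ¹(ℤ^D)`. -/
noncomputable def gridSampleLinearEquiv {D : ℕ} {ε : ℝ} (hε : 0 < ε) :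
    GridL1 D ε ≃ₗ[ℝ] SeqL1 D where
  toFun a := ⟨gridAverage ε (a : L1 D),
    memℓp_gen (by simpa using GridL1.summable_norm_gridAverage hε a)⟩
  map_add' a b := Subtype.ext (gridAverage_add ε (a : L1 D) b)
  map_smul' c a := Subtype.ext (gridAverage_smul ε c (a : L1 D))
  invFun := gridFunction hε
  left_inv a := by
    refine Subtype.ext (Lp.ext ?_)
    exact (coeFn_gridFunction hε _).trans (GridL1.ae_eq_gridAverage hε a).symm
  right_inv u := Subtype.ext (gridAverage_eq_of_ae_eq hε (coeFn_gridFunction hε u))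

theorem norm_eq_norm_gridSampleLinearEquiv {D : ℕ} {ε : ℝ} (hε : 0 < ε) (a : GridL1 D ε) :
    ‖a‖ = ε ^ D * ‖gridSampleLinearEquiv hε a‖ := by
  rw [SeqL1.norm_eq_tsum, ← tsum_mul_left]
  exact (GridL1.hasSum_norm_gridAverage hε a).tsum_eq.symm

/-- Sampling on the cubes, as an isomorphism of Banach spaces `𝐋¹_ε ≃ ℓ¹(ℤ^D)`. -/
noncomputable def gridSample {D : ℕ} {ε : ℝ} (hε : 0 < ε) : GridL1 D ε ≃L[ℝ] SeqL1 D :=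
  (gridSampleLinearEquiv hε).toContinuousLinearEquivOfBounds (ε ^ D)⁻¹ (ε ^ D)
    (fun a => by
      rw [norm_eq_norm_gridSampleLinearEquiv hε a, inv_mul_cancel_left₀ (pow_pos hε D).ne'])
    (fun u => by
      rw [norm_eq_norm_gridSampleLinearEquiv hε, LinearEquiv.apply_symm_apply])

theorem coe_gridSample {D : ℕ} {ε : ℝ} (hε : 0 < ε) (a : GridL1 D ε) :
    (gridSample hε a : (Fin D → ℤ) → ℝ) = gridAverage ε (a : L1 D) := rfl

/-- The Larger than Life automaton whose weights are the reflected masses of the discretized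
kernel. -/
noncomputable def gridLtL {D : ℕ} (κ : LifeKernel D) {ε : ℝ} (hε : 0 < ε) : LtLData D where
  nbhd := (finite_support_gridMass κ hε).toFinset.map (Equiv.neg _).toEmbedding
  weight k := gridMass κ ε (-k)
  weight_nonneg k _ := gridMass_nonneg κ ε (-k)
  weight_sum := by simpa using sum_gridMass κ hε

/-- Subtracting `ε z` lowers the cube index by exactly `z`, so the convolution is a lattice sum
after the substitution `k = -z`. -/
theorem gridConv_gridExp {D : ℕ} (κ : LifeKernel D) {ε : ℝ} (hε : 0 < ε) (a : L1 D)
    (x : Fin D → ℝ) : gridConv κ ε (gridExp ε a) x =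
      (gridLtL κ hε).density (gridAverage ε a) (cubeIndex ε x) := by
  rw [gridConv_eq_sum κ hε, LtLData.density, gridLtL, Finset.sum_map]
  refine Finset.sum_congr rfl fun z _ => ?_
  simp only [gridExp, cubeIndex_sub_gridPoint hε, gridAverage, Equiv.coe_toEmbedding,
    Equiv.neg_apply, neg_neg, ← sub_eq_add_neg]

theorem gridAverage_discreteLife {D : ℕ} (θ : Thresholds) (κ : LifeKernel D) {ε : ℝ}
    (hε : 0 < ε) (a : L1 D) : gridAverage ε (discreteLife θ κ ε hε a : L1 D) =
      (gridLtL κ hε).extended θ (gridAverage ε a) := by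
  refine gridAverage_eq_of_ae_eq hε ((coeFn_discreteLife θ κ hε a).trans
    (Eventually.of_forall fun x => ?_))
  simp only [gridConv_gridExp κ hε, LtLData.extended]
  rfl

/-! ### Zero-one configurations -/

theorem lifeRule_eq_ite (θ : Thresholds) {t : ℝ} (ht : t = 0 ∨ t = 1) (α : ℝ) :
    lifeRule θ t α = open Classical in
      if t = 1 ∧ θ.s₀ ≤ α ∧ α ≤ θ.s₁ then 1
      else if t = 0 ∧ θ.b₀ ≤ α ∧ α ≤ θ.b₁ then 1 else 0 := by
  rcases ht with rfl | rfl <;> simp [lifeRule, indicator_apply]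

theorem lifeRule_eq_zero_or_one (θ : Thresholds) {t : ℝ} (ht : t = 0 ∨ t = 1) (α : ℝ) :
    lifeRule θ t α = 0 ∨ lifeRule θ t α = 1 := by
  rw [lifeRule_eq_ite θ ht]
  split_ifs <;> simp

theorem LtLData.extended_eq_automaton {D : ℕ} (N : LtLData D) (θ : Thresholds)
    {u : (Fin D → ℤ) → ℝ} (hu : ∀ z, u z = 0 ∨ u z = 1) : N.extended θ u = N.automaton θ u :=
  funext fun z => lifeRule_eq_ite θ (hu z) (N.density u z)

theorem GridL1.mem_configs_iff {D : ℕ} {ε : ℝ} (hε : 0 < ε) (a : GridL1 D ε) :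
    (a : L1 D) ∈ configs D ↔
      ∀ z, gridAverage ε (a : L1 D) z = 0 ∨ gridAverage ε (a : L1 D) z = 1 := by
  have h := GridL1.ae_eq_gridAverage hε a
  constructor
  · intro ha z
    by_contra hz
    -- A value other than `0` and `1` would be taken on a whole cube, which has positive measure.
    refine volume_cube_ne_zero hε z (measure_mono_null (fun x hx => ?_)
      (ae_iff.1 ((show ∀ᵐ x, (a : L1 D) x = 0 ∨ (a : L1 D) x = 1 from ha).and h)))
    rintro ⟨h1, h2⟩
    simp only [h2, (mem_cube_iff hε x z).1 hx] at h1
    exact hz h1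
  · intro hz
    change ∀ᵐ x, _
    filter_upwards [h] with x hx
    rw [hx]
    exact hz _

/-- Summable values are below `1` outside a finite set. -/
theorem SeqL1.finite_support_of_zero_or_one {D : ℕ} (u : SeqL1 D)
    (hu : ∀ z, u z = 0 ∨ u z = 1) : (Function.support (u : (Fin D → ℤ) → ℝ)).Finite := by
  have h := (SeqL1.summable_norm u).tendsto_cofinite_zero.eventually_lt_const one_pos
  refine (Filter.eventually_cofinite.1 h).subset fun z hz => ?_
  have h1 : u z = 1 := (hu z).resolve_left hz
  simp [h1]

theorem GridL1.mem_configs_iff_gridSample {D : ℕ} {ε : ℝ} (hε : 0 < ε) (a : GridL1 D ε) :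
    (a : L1 D) ∈ configs D ↔ gridSample hε a ∈ latticeConfigs D := by
  rw [GridL1.mem_configs_iff hε]
  exact ⟨fun h => ⟨h, SeqL1.finite_support_of_zero_or_one (gridSample hε a) h⟩, fun h => h.1⟩

theorem isLifeIsomorphism_gridSample {D : ℕ} (θ : Thresholds) (κ : LifeKernel D) {ε : ℝ}
    (hε : 0 < ε) : IsLifeIsomorphism θ κ ε hε (gridLtL κ hε) (gridSample hε) where
  sample a := GridL1.ae_eq_gridAverage hε a
  norm_eq a := norm_eq_norm_gridSampleLinearEquiv hε a
  conj a := gridAverage_discreteLife θ κ hε a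
  mem_configs_iff a := GridL1.mem_configs_iff_gridSample hε a
  mapsTo_configs a ha := by
    rw [GridL1.mem_configs_iff hε] at ha ⊢
    rw [gridAverage_discreteLife]
    exact fun z => lifeRule_eq_zero_or_one θ (ha z) _
  conj_configs a ha := by
    rw [coe_gridSample, coe_gridSample, gridAverage_discreteLife]
    exact LtLData.extended_eq_automaton _ θ ((GridL1.mem_configs_iff hε a).1 ha)

/-! ### The radius of the neighbourhood -/

theorem exists_abs_le_div_of_gridMass_ne_zero {D : ℕ} (κ : LifeKernel D) :
    ∃ C : ℝ, ∀ ε : ℝ, 0 < ε → ∀ z, gridMass κ ε z ≠ 0 → ∀ i, |(z i : ℝ)| ≤ C / ε := by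
  obtain ⟨K, hK, hK0⟩ := κ.compact_support
  obtain ⟨R, hR⟩ := hK.isBounded.exists_norm_le
  -- A cube of nonzero mass meets `K`, whence `ε |z i| ≤ |R| + ε / 2`. If `z i ≠ 0`, then `ε / 2 ≤ ε
  -- |z i| / 2` is absorbed on the left, which doubles `|R|`; so one constant serves large `ε` too.
  refine ⟨2 * |R|, fun ε hε z hz i => ?_⟩
  by_contra hlt
  refine hz (integral_eq_zero_of_ae ?_)
  rw [Filter.EventuallyEq, ae_restrict_iff' (measurableSet_cube ε z)]
  filter_upwards [hK0] with x hx hxz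
  refine hx fun hxK => hlt ?_
  have hxi : |x i| ≤ |R| := (norm_le_pi_norm x i).trans ((hR x hxK).trans (le_abs_self R))
  have hc := hxz i (mem_univ i)
  have h1 : ε * |(z i : ℝ)| ≤ |R| + ε / 2 := by
    rw [← abs_of_pos hε, ← abs_mul, abs_of_pos hε, abs_le]
    rw [abs_le] at hxi
    constructor <;> linarith [hc.1, hc.2]
  rw [le_div_iff₀ hε]
  rcases eq_or_ne (z i) 0 with h0 | h0
  · simp [h0]
  · have h2 : (1 : ℝ) ≤ |(z i : ℝ)| := by exact_mod_cast Int.one_le_abs h0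
    nlinarith

end RealLife

theorem mainTheorem1 (D : ℕ) (θ : RealLife.Thresholds) (κ : RealLife.LifeKernel D) :
    (∀ a ∈ RealLife.regularConfigs θ κ,
      Filter.Tendsto
        (fun ε : Set.Ioi (0 : ℝ) =>
          (RealLife.discreteLife θ κ (ε : ℝ) ε.2 a : RealLife.L1 D))
        (Filter.comap (fun ε : Set.Ioi (0 : ℝ) => (ε : ℝ)) (nhds 0))
        (nhds (RealLife.realLife θ κ a))) ∧
    (∃ C : ℝ, ∀ (ε : ℝ) (hε : 0 < ε), ∃ (N : RealLife.LtLData D)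
      (T : RealLife.GridL1 D ε ≃L[ℝ] RealLife.SeqL1 D),
      N.RadiusLE (C / ε) ∧ RealLife.IsLifeIsomorphism θ κ ε hε N T) ∧
    (∀ (ε : ℕ → ℝ) (hε : ∀ n, 0 < ε n), Filter.Tendsto ε Filter.atTop (nhds 0) →
      RealLife.EvolvesOn
        (fun n a => (RealLife.discreteLife θ κ (ε n) (hε n) a : RealLife.L1 D))
        (RealLife.realLife θ κ) (RealLife.regularConfigs θ κ)) := by
  refine ⟨fun a ha => RealLife.tendsto_discreteLife_nhds_zero θ κ ha, ?_, fun ε hε hlim => ?_⟩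
  · obtain ⟨C, hC⟩ := RealLife.exists_abs_le_div_of_gridMass_ne_zero κ
    refine ⟨C, fun ε hε => ⟨RealLife.gridLtL κ hε, RealLife.gridSample hε, fun k hk i => ?_,
      RealLife.isLifeIsomorphism_gridSample θ κ hε⟩⟩
    obtain ⟨z, hz, rfl⟩ := Finset.mem_map.1 hk
    simpa using hC ε hε z (by simpa using hz) i
  · exact RealLife.evolvesOn_of_tendsto
      (fun v a ha => RealLife.shift_mem_regularConfigs ha v)
      fun as a ha has => RealLife.tendsto_discreteLife θ κ ha has hε hlim
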